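/- Work in the universe $V$ of sets (with the axiom of choice). For an ordinal $\alpha$ let $V_\alpha$ be the $\alpha$-th level of the von Neumann hierarchy; ordinals are von Neumann ordinals. Let $A\subseteq V$ be any class and $\kappa$ a cardinal. For an ordinal $\lambda>\kappa$, an *$A$-extendibility embedding of degree $\lambda$ for $\kappa$* is, for some ordinal $\theta$, an elementary embedding $$j:\langle V_\lambda,\in,A\cap V_\lambda\rangle\to\langle V_\theta,\in,A\cap V_\theta\rangle$$ with critical point $\kappa$ (that is, $\kappa$ is the least ordinal with $j(\kappa)\neq\kappa$) and with $\lambda<j(\kappa)$. The cardinal $\kappa$ is *$A$-extendible* if for every ordinal $\lambda>\kappa$ there is an $A$-extendibility embedding of degree $\lambda$ for $\kappa$. A set $g\subseteq\kappa$ is *$A$-stretchable* if for every ordinal $\lambda>\kappa$ and every $h\subseteq\lambda$ with $h\cap\kappa=g$ there is an $A$-extendibility embedding $j$ of degree $\lambda$ for $\kappa$ with $j(g)\cap\lambda=h$. **Theorem.** If $\kappa$ is $A$-extendible for some class $A$, then there is an $A$-stretchable set $g\subseteq\kappa$. -/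

import Mathlib

open scoped FirstOrder ZFSet

universe u

namespace AExtendible

/-- The relation symbols of the language of set theory with one additional unary predicate. -/
inductive SetRel : ℕ → Type
  | mem : SetRel 2
  | pred : SetRel 1

/-- The first-order language of set theory expanded by a unary predicate symbol. -/
def setLanguage : FirstOrder.Language := ⟨fun _ => Empty, SetRel⟩

/-- The underlying set of the structure `⟨V_α, ∈, A ∩ V_α⟩`. The class `A` is recorded in the type
so that the structure can be found from it. -/
def Level (_A : Class.{u}) (α : Ordinal.{u}) : Type (u + 1) := {x : ZFSet.{u} // x ∈ V_ α}

/-- The first-order structure `⟨V_α, ∈, A ∩ V_α⟩`. -/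
instance levelStructure (A : Class.{u}) (α : Ordinal.{u}) :
    setLanguage.Structure (Level A α) where
  funMap := fun f => Empty.elim f
  RelMap := fun R =>
    match R with
    | .mem => fun x => (x 0).1 ∈ (x 1).1
    | .pred => fun x => A (x 0).1

/-- A subset of an ordinal below `α` (in particular an ordinal below `α`) belongs to `V_α`. -/
theorem mem_level_of_subset {κ α : Ordinal.{u}} (hκ : κ < α) {g : ZFSet.{u}}
    (hg : g ⊆ κ.toZFSet) : g ∈ V_ α := by
  rw [ZFSet.mem_vonNeumann]
  have h := ZFSet.rank_mono hg
  rw [Ordinal.rank_toZFSet] at h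
  exact h.trans_lt hκ

/-- The element of `V_α` given by a subset `g` of an ordinal `κ < α`. -/
def Level.ofSubset (A : Class.{u}) {κ α : Ordinal.{u}} (hκ : κ < α) (g : ZFSet.{u})
    (hg : g ⊆ κ.toZFSet) : Level A α :=
  ⟨g, mem_level_of_subset hκ hg⟩

/-- The von Neumann ordinal `κ < α` as an element of `V_α`. -/
noncomputable def Level.ofOrdinal (A : Class.{u}) {κ α : Ordinal.{u}} (hκ : κ < α) : Level A α :=
  Level.ofSubset A hκ κ.toZFSet (fun _ h => h)

/-- `κ` is the critical point of `j : V_α → V_θ`, the least ordinal moved by `j`. -/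
def IsCriticalPoint {A : Class.{u}} {α θ : Ordinal.{u}}
    (j : Level A α ↪ₑ[setLanguage] Level A θ) (κ : Ordinal.{u}) : Prop :=
  (∃ hκ : κ < α, (j (Level.ofOrdinal A hκ)).1 ≠ κ.toZFSet) ∧
    ∀ (β : Ordinal.{u}) (hβ : β < α), β < κ → (j (Level.ofOrdinal A hβ)).1 = β.toZFSet

/-- `j : ⟨V_lam, ∈, A ∩ V_lam⟩ → ⟨V_θ, ∈, A ∩ V_θ⟩` is an `A`-extendibility embedding of degree
`lam` for `κ`: it is elementary, has critical point `κ`, and `lam < j(κ)`. -/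
def IsExtendibilityEmbedding {A : Class.{u}} {κ lam θ : Ordinal.{u}} (hκ : κ < lam)
    (j : Level A lam ↪ₑ[setLanguage] Level A θ) : Prop :=
  IsCriticalPoint j κ ∧ lam.toZFSet ∈ (j (Level.ofOrdinal A hκ)).1

/-- The cardinal `κ` is `A`-extendible: for every ordinal `lam > κ` there is an `A`-extendibility
embedding of degree `lam` with critical point `κ`. -/
def IsExtendible (A : Class.{u}) (κ : Cardinal.{u}) : Prop :=
  ∀ (lam : Ordinal.{u}) (hκ : κ.ord < lam),
    ∃ (θ : Ordinal.{u}) (j : Level A lam ↪ₑ[setLanguage] Level A θ), IsExtendibilityEmbedding hκ j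

/-- The set `g ⊆ κ` is `A`-stretchable: for every ordinal `lam > κ` and every `h ⊆ lam` with
`h ∩ κ = g` there is an `A`-extendibility embedding `j` of degree `lam` with critical point `κ` and
`j(g) ∩ lam = h`. -/
def IsStretchable (A : Class.{u}) (κ : Cardinal.{u}) (g : ZFSet.{u})
    (hg : g ⊆ κ.ord.toZFSet) : Prop :=
  ∀ (lam : Ordinal.{u}) (hκ : κ.ord < lam) (h : ZFSet.{u}),
    h ⊆ lam.toZFSet → h ∩ κ.ord.toZFSet = g →
      ∃ (θ : Ordinal.{u}) (j : Level A lam ↪ₑ[setLanguage] Level A θ),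
        IsExtendibilityEmbedding hκ j ∧ (j (Level.ofSubset A hκ g hg)).1 ∩ lam.toZFSet = h

end AExtendible

namespace AExtendible

open FirstOrder FirstOrder.Language ZFSet

/-! The set `g` is built by a Laver-style diamond recursion. At a stage `γ < κ` not overshot by
earlier stages, suppose that some `h ⊆ l` with `l < κ` extends `g ∩ γ` but is realised by no
extendibility embedding for `γ`. Then `g` copies such an `h` of least length `l` on the interval
from `γ` to `l`, and `f` records `l` as `f(γ)` (`exists_bookkeeping`).

To realise a given `h ⊆ l` extending `g`, take an embedding `J` of large degree with critical point
`κ`. Then `J(g) ∩ κ = g`, and `κ` is a closed stage of the recursion `J(g)`, `J(f)`. If `J(f)`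
prescribed some `s ≤ l` at `κ`, then `J(g) ∩ s` would be a set realised by no embedding; but the
restriction of `J` to `V_s` realises exactly this set. So nothing of length at most `l` fails at
`κ`, and `h` is realised (`IsTransfer.exists_isStretch`).

For this argument, embeddings are coded as sets and statements about them are transferred by
predicates defined by one formula, correct in every level. Being elementary is a conjunction over
all formulas, so it is transferred separately, by numbering the formulas with natural numbers, which
`J` fixes (`IsTransfer.mem_map_embeddings_iff`). -/

/-- `P` is computed by a single formula in all the structures `⟨V_α, ∈, A ∩ V_α⟩`. -/
def AbsolutelyDefinable (A : Class.{u}) {ι : Type} (P : (ι → ZFSet.{u}) → Prop) : Prop :=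
  ∃ φ : setLanguage.Formula ι, ∀ (α : Ordinal.{u}) (v : ι → Level A α),
    φ.Realize v ↔ P fun i => (v i).1

/-! ### Closure properties of absolute definability. -/

namespace AbsolutelyDefinable

variable {A : Class.{u}} {ι : Type} {P Q : (ι → ZFSet.{u}) → Prop}

theorem congr (hP : AbsolutelyDefinable A P) (h : ∀ v, P v ↔ Q v) : AbsolutelyDefinable A Q :=
  (funext fun v => propext (h v) : P = Q) ▸ hP

theorem mem (i k : ι) : AbsolutelyDefinable A fun v => v i ∈ v k :=
  ⟨Relations.formula₂ (L := setLanguage) SetRel.mem (Term.var i) (Term.var k), fun _ _ =>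
    Formula.realize_rel₂.trans Iff.rfl⟩

theorem pred (i : ι) : AbsolutelyDefinable A fun v => A (v i) :=
  ⟨Relations.formula₁ (L := setLanguage) SetRel.pred (Term.var i), fun _ _ =>
    Formula.realize_rel₁.trans Iff.rfl⟩

theorem eq (i k : ι) : AbsolutelyDefinable A fun v => v i = v k :=
  ⟨Term.equal (Term.var i) (Term.var k), fun α v => by
    rw [Formula.realize_equal]; exact Subtype.ext_iff⟩

theorem false : AbsolutelyDefinable A fun _ : ι → ZFSet.{u} => False :=
  ⟨⊥, fun α v => by simp⟩

theorem imp (hP : AbsolutelyDefinable A P) (hQ : AbsolutelyDefinable A Q) :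
    AbsolutelyDefinable A fun v => P v → Q v := by
  obtain ⟨φ, hφ⟩ := hP
  obtain ⟨ψ, hψ⟩ := hQ
  exact ⟨φ.imp ψ, fun α v => by rw [Formula.realize_imp, hφ, hψ]⟩

theorem not (hP : AbsolutelyDefinable A P) : AbsolutelyDefinable A fun v => ¬ P v :=
  hP.imp false

theorem or (hP : AbsolutelyDefinable A P) (hQ : AbsolutelyDefinable A Q) :
    AbsolutelyDefinable A fun v => P v ∨ Q v :=
  (hP.not.imp hQ).congr fun _ => or_iff_not_imp_left.symm

theorem and (hP : AbsolutelyDefinable A P) (hQ : AbsolutelyDefinable A Q) :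
    AbsolutelyDefinable A fun v => P v ∧ Q v :=
  (hP.imp hQ.not).not.congr fun _ => by tauto

theorem iff (hP : AbsolutelyDefinable A P) (hQ : AbsolutelyDefinable A Q) :
    AbsolutelyDefinable A fun v => P v ↔ Q v :=
  ((hP.imp hQ).and (hQ.imp hP)).congr fun _ => iff_def.symm

/-- Quantification over finite tuples, absolute if the components of a counterexample cannot have
larger rank than all the free variables. -/
theorem forall_of_rank_le {β : Type} [Finite β] {P : (ι → ZFSet.{u}) → (β → ZFSet.{u}) → Prop}
    (hP : AbsolutelyDefinable A fun w : ι ⊕ β → ZFSet.{u} =>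
      P (fun i => w (.inl i)) (fun b => w (.inr b)))
    (hb : ∀ v x, ¬ P v x → ∀ b, ∃ i, (x b).rank ≤ (v i).rank) :
    AbsolutelyDefinable A fun v => ∀ x, P v x := by
  obtain ⟨φ, hφ⟩ := hP
  refine ⟨φ.iAlls β, fun α v => ?_⟩
  rw [Formula.realize_iAlls]
  constructor
  · intro h x
    by_contra hx
    have hm : ∀ b, x b ∈ V_ α := fun b => by
      obtain ⟨i, hi⟩ := hb _ _ hx b
      exact mem_vonNeumann.2 (hi.trans_lt (mem_vonNeumann.1 (v i).2))
    exact hx ((hφ α _).1 (h fun b => ⟨x b, hm b⟩))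
  · intro h x
    exact (hφ α _).2 (h _)

theorem all {P : (ι → ZFSet.{u}) → ZFSet.{u} → Prop}
    (hP : AbsolutelyDefinable A fun w : ι ⊕ Unit → ZFSet.{u} =>
      P (fun i => w (.inl i)) (w (.inr ())))
    (hb : ∀ v x, ¬ P v x → ∃ i, x.rank ≤ (v i).rank) :
    AbsolutelyDefinable A fun v => ∀ x, P v x :=
  (forall_of_rank_le (β := Unit) (P := fun v x => P v (x ())) hP fun v _ h _ => hb v _ h).congr
    fun _ => ⟨fun h x => h fun _ => x, fun h x => h _⟩

theorem ex {P : (ι → ZFSet.{u}) → ZFSet.{u} → Prop}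
    (hP : AbsolutelyDefinable A fun w : ι ⊕ Unit → ZFSet.{u} =>
      P (fun i => w (.inl i)) (w (.inr ())))
    (hb : ∀ v x, P v x → ∃ i, x.rank ≤ (v i).rank) :
    AbsolutelyDefinable A fun v => ∃ x, P v x :=
  (all (P := fun v x => ¬ P v x) hP.not fun v x h => hb v x (not_not.1 h)).not.congr
    fun _ => not_forall_not

theorem ball {P : (ι → ZFSet.{u}) → ZFSet.{u} → Prop} {i : ι}
    (hP : AbsolutelyDefinable A fun w : ι ⊕ Unit → ZFSet.{u} =>
      P (fun i => w (.inl i)) (w (.inr ()))) :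
    AbsolutelyDefinable A fun v => ∀ x ∈ v i, P v x :=
  all (P := fun v x => x ∈ v i → P v x) ((mem _ _).imp hP) fun _ _ h =>
    ⟨i, (rank_lt_of_mem (Classical.not_imp.1 h).1).le⟩

theorem bex {P : (ι → ZFSet.{u}) → ZFSet.{u} → Prop} {i : ι}
    (hP : AbsolutelyDefinable A fun w : ι ⊕ Unit → ZFSet.{u} =>
      P (fun i => w (.inl i)) (w (.inr ()))) :
    AbsolutelyDefinable A fun v => ∃ x ∈ v i, P v x :=
  ex (P := fun v x => x ∈ v i ∧ P v x) ((mem _ _).and hP) fun _ _ h =>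
    ⟨i, (rank_lt_of_mem h.1).le⟩

theorem subset (i k : ι) : AbsolutelyDefinable A fun v => v i ⊆ v k :=
  (ball (P := fun v x => x ∈ v k) (i := i) (mem _ _)).congr fun _ => Iff.rfl

theorem eq_empty (i : ι) : AbsolutelyDefinable A fun v => v i = ∅ :=
  (ball (P := fun _ _ => False) (i := i) false).congr fun _ => (ZFSet.eq_empty _).symm

theorem eq_succ (i k : ι) : AbsolutelyDefinable A fun v => v i = insert (v k) (v k) :=
  ((ball (P := fun v x => x = v k ∨ x ∈ v k) (i := i) ((eq _ _).or (mem _ _))).and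
    ((mem k i).and (subset k i))).congr fun v => by
    constructor
    · rintro ⟨h₁, h₂, h₃⟩
      ext x
      rw [mem_insert_iff]
      exact ⟨h₁ x, fun h => h.elim (fun h => h ▸ h₂) (fun h => h₃ h)⟩
    · intro h
      refine ⟨fun x hx => mem_insert_iff.1 (h ▸ hx), h ▸ mem_insert _ _, fun x hx => ?_⟩
      rw [h]
      exact mem_insert_of_mem _ hx

theorem eq_inter (i k l : ι) : AbsolutelyDefinable A fun v => v i = v k ∩ v l :=
  (((subset i k).and (subset i l)).and
    (ball (P := fun v x => x ∈ v l → x ∈ v i) (i := k) ((mem _ _).imp (mem _ _)))).congr fun v => by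
    constructor
    · rintro ⟨⟨h₁, h₂⟩, h₃⟩
      ext x
      rw [mem_inter]
      exact ⟨fun h => ⟨h₁ h, h₂ h⟩, fun h => h₃ x h.1 h.2⟩
    · intro h
      simp only [subset_def, h, mem_inter]
      tauto

theorem eq_pair_set (i k l : ι) : AbsolutelyDefinable A fun v => v i = {v k, v l} :=
  (((mem k i).and (mem l i)).and
    (ball (P := fun v x => x = v k ∨ x = v l) (i := i) ((eq _ _).or (eq _ _)))).congr fun v => by
    constructor
    · rintro ⟨⟨h₁, h₂⟩, h₃⟩
      ext x
      rw [mem_pair]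
      exact ⟨h₃ x, fun h => h.elim (fun h => h ▸ h₁) (fun h => h ▸ h₂)⟩
    · intro h
      simp only [h, mem_pair]
      tauto

/-- Both components of a Kuratowski pair are elements of it, so bounded quantifiers suffice. The
singleton is written `{v k, v k}` to reuse `eq_pair_set`. -/
theorem eq_pair (i k l : ι) : AbsolutelyDefinable A fun v => v i = pair (v k) (v l) :=
  congr (P := fun v => ∃ s ∈ v i, s = {v k, v k} ∧ ∃ t ∈ v i, t = {v k, v l} ∧ v i = {s, t})
    (.bex (.and (eq_pair_set _ _ _) (.bex (.and (eq_pair_set _ _ _) (eq_pair_set _ _ _)))))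
    fun v => by
    constructor
    · rintro ⟨s, -, rfl, t, -, rfl, h⟩
      rw [h, pair, pair_eq_singleton]
    · intro h
      refine ⟨_, ?_, rfl, _, ?_, rfl, ?_⟩ <;> simp only [h, pair, pair_eq_singleton] <;> simp

theorem pair_mem (i k l : ι) : AbsolutelyDefinable A fun v => pair (v i) (v k) ∈ v l :=
  (bex (P := fun v p => p = pair (v i) (v k)) (i := l) (eq_pair _ _ _)).congr fun v => by
    simp

end AbsolutelyDefinable

/-! ### Ranks of pairs, and a definition of the levels `V_β`. -/

theorem rank_left_lt_rank_pair (a b : ZFSet.{u}) : a.rank < (pair a b).rank := by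
  rw [pair, rank_pair, rank_singleton]
  exact (Order.lt_succ _).trans (lt_max_of_lt_left (Order.lt_succ _))

theorem rank_right_lt_rank_pair (a b : ZFSet.{u}) : b.rank < (pair a b).rank := by
  rw [pair, rank_pair, rank_pair]
  exact (lt_max_of_lt_right (Order.lt_succ _)).trans (lt_max_of_lt_right (Order.lt_succ _))

theorem pair_mem_vonNeumann {η : Ordinal.{u}} (hη : Order.IsSuccLimit η) {a b : ZFSet.{u}}
    (ha : a ∈ V_ η) (hb : b ∈ V_ η) : pair a b ∈ V_ η := by
  rw [mem_vonNeumann] at *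
  rw [pair, rank_pair, rank_pair, rank_singleton]
  simp only [max_lt_iff]
  exact ⟨hη.succ_lt (hη.succ_lt ha), hη.succ_lt (max_lt (hη.succ_lt ha) (hη.succ_lt hb))⟩

/-- A history is a set all of whose elements consist of the subsets of their elements lying in
it. -/
theorem eq_vonNeumann_of_history {h : ZFSet.{u}}
    (hh : ∀ x ∈ h, ∀ y, y ∈ x ↔ ∃ c ∈ h, c ∈ x ∧ y ⊆ c) : ∀ x ∈ h, x = V_ x.rank := by
  intro x
  induction x using ZFSet.inductionOn with
  | _ x ih =>
    intro hx
    ext y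
    rw [hh x hx, mem_vonNeumann]
    constructor
    · rintro ⟨c, hc, hcx, hyc⟩
      exact (rank_mono hyc).trans_lt (rank_lt_of_mem hcx)
    · intro hy
      obtain ⟨z, hz, hyz⟩ := lt_rank_iff.1 hy
      obtain ⟨c, hc, hcx, hzc⟩ := (hh x hx z).1 hz
      refine ⟨c, hc, hcx, ?_⟩
      rw [ih c hcx hc, subset_vonNeumann]
      exact hyz.trans (rank_mono hzc)

/-- The witness is the set of all levels `V_δ` with `δ < β`. The clause `h ⊆ s` bounds its rank by
that of `s`, which makes the quantifier over `h` absolute. -/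
theorem exists_eq_vonNeumann_iff (s : ZFSet.{u}) : (∃ β, s = V_ β) ↔
    ∃ h, (∀ x ∈ h, ∀ y, y ∈ x ↔ ∃ c ∈ h, c ∈ x ∧ y ⊆ c) ∧ (∀ y, y ∈ s ↔ ∃ c ∈ h, y ⊆ c) ∧
      h ⊆ s := by
  constructor
  · rintro ⟨β, rfl⟩
    refine ⟨ZFSet.sep (fun x => ∃ δ, x = V_ δ) (V_ β), ?_, fun y => ?_, sep_subset⟩
    · simp only [mem_sep]
      rintro _ ⟨hx, δ, rfl⟩ y
      rw [mem_vonNeumann']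
      have hδ : δ < β := by simpa using hx
      constructor
      · rintro ⟨a, ha, hy⟩
        exact ⟨V_ a, ⟨by simpa using ha.trans hδ, a, rfl⟩, by simpa using ha, hy⟩
      · rintro ⟨_, ⟨-, a, rfl⟩, ha, hy⟩
        exact ⟨a, by simpa using ha, hy⟩
    · rw [mem_vonNeumann']
      simp only [mem_sep]
      constructor
      · rintro ⟨a, ha, hy⟩
        exact ⟨V_ a, ⟨by simpa using ha, a, rfl⟩, hy⟩
      · rintro ⟨_, ⟨hb, a, rfl⟩, hy⟩
        exact ⟨a, by simpa using hb, hy⟩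
  · rintro ⟨h, hh, hs, hsub⟩
    refine ⟨s.rank, ?_⟩
    ext y
    rw [hs, mem_vonNeumann]
    constructor
    · rintro ⟨c, hc, hyc⟩
      exact (rank_mono hyc).trans_lt (rank_lt_of_mem (hsub hc))
    · intro hy
      obtain ⟨z, hz, hyz⟩ := lt_rank_iff.1 hy
      obtain ⟨c, hc, hzc⟩ := (hs z).1 hz
      refine ⟨c, hc, ?_⟩
      rw [eq_vonNeumann_of_history hh c hc, subset_vonNeumann]
      exact hyz.trans (rank_mono hzc)

namespace AbsolutelyDefinable

variable {A : Class.{u}} {ι : Type}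

theorem eq_vonNeumann (i : ι) : AbsolutelyDefinable A fun v => ∃ β, v i = V_ β := by
  refine congr ?_ fun v => (exists_eq_vonNeumann_iff _).symm
  refine ex (.and (.ball (.all (.iff (mem _ _) (.bex (.and (mem _ _) (subset _ _)))) ?_))
    (.and (.all (.iff (mem _ _) (.bex (subset _ _))) ?_) (subset _ _))) ?_
  -- A counterexample to the equivalence is an element of one side or a subset of a member of the
  -- history, so its rank is bounded by that of a free variable.
  · intro v x h
    by_cases hx : x ∈ v (.inr ())
    · exact ⟨_, (rank_lt_of_mem hx).le⟩
    · simp only [hx, false_iff, not_not] at h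
      obtain ⟨c, hc, -, hxc⟩ := h
      exact ⟨_, (rank_mono hxc).trans (rank_lt_of_mem hc).le⟩
  · intro v x h
    by_cases hx : x ∈ v (.inl i)
    · exact ⟨_, (rank_lt_of_mem hx).le⟩
    · simp only [hx, false_iff, not_not] at h
      obtain ⟨c, hc, hxc⟩ := h
      exact ⟨_, (rank_mono hxc).trans (rank_lt_of_mem hc).le⟩
  · rintro v x ⟨-, -, h⟩
    exact ⟨i, rank_mono h⟩

end AbsolutelyDefinable

/-! ### Satisfaction in a level and preservation of formulas. -/

/-- The variable a term of the relational language `setLanguage` consists of. -/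
def termVar {β : Type} : setLanguage.Term β → β
  | .var b => b
  | .func f _ => Empty.elim f

theorem realize_eq_termVar {A : Class.{u}} {α : Ordinal.{u}} {β : Type} (t : setLanguage.Term β)
    (v : β → Level A α) : t.realize v = v (termVar t) := by
  cases t with
  | var b => rfl
  | func f _ => exact Empty.elim f

/-- The interpretation of the relation symbols in the universe of sets. -/
def RelHolds (A : Class.{u}) : ∀ {l : ℕ}, SetRel l → (Fin l → ZFSet.{u}) → Prop
  | _, .mem, x => x 0 ∈ x 1
  | _, .pred, x => A (x 0)

/-- The satisfaction relation of `⟨v, ∈, A ∩ v⟩`. -/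
def Satisfies (A : Class.{u}) {α : Type} : ∀ {n : ℕ}, setLanguage.BoundedFormula α n →
    ZFSet.{u} → (α → ZFSet.{u}) → (Fin n → ZFSet.{u}) → Prop
  | _, .falsum, _, _, _ => False
  | _, .equal s t, _, a, xs => Sum.elim a xs (termVar s) = Sum.elim a xs (termVar t)
  | _, .rel R ts, _, a, xs => RelHolds A R fun i => Sum.elim a xs (termVar (ts i))
  | _, .imp φ ψ, v, a, xs => Satisfies A φ v a xs → Satisfies A ψ v a xs
  | _, .all φ, v, a, xs => ∀ x ∈ v, Satisfies A φ v a (Fin.snoc xs x)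

theorem satisfies_vonNeumann {A : Class.{u}} {β : Type} {α : Ordinal.{u}} {n : ℕ}
    (φ : setLanguage.BoundedFormula β n) (a : β → Level A α) (xs : Fin n → Level A α) :
    Satisfies A φ (V_ α) (fun i => (a i).1) (fun i => (xs i).1) ↔ φ.Realize a xs := by
  have key : ∀ {n : ℕ} (xs : Fin n → Level A α) (s : β ⊕ Fin n),
      Sum.elim (fun i => (a i).1) (fun i => (xs i).1) s = (Sum.elim a xs s).1 := by
    rintro n xs (s | s) <;> rfl
  induction φ with
  | falsum => rfl
  | equal s t =>
    simp only [Satisfies, BoundedFormula.Realize, realize_eq_termVar, key]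
    exact Subtype.ext_iff.symm
  | rel R ts =>
    simp only [Satisfies, BoundedFormula.Realize, realize_eq_termVar, key]
    cases R <;> exact Iff.rfl
  | imp φ ψ ih₁ ih₂ => simp only [Satisfies, BoundedFormula.Realize, ih₁, ih₂]
  | all φ ih =>
    simp only [Satisfies, BoundedFormula.Realize, ← ih]
    have hs : ∀ x : Level A α, (fun i => ((Fin.snoc xs x : Fin _ → Level A α) i).1) =
        (Fin.snoc (fun i => (xs i).1) x.1 : Fin _ → ZFSet.{u}) := fun x =>
      Fin.comp_snoc (fun y : Level A α => y.1) xs x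
    simp only [hs]
    exact ⟨fun h x => h x.1 x.2, fun h x hx => h ⟨x, hx⟩⟩

namespace AbsolutelyDefinable

variable {A : Class.{u}} {ι : Type}

theorem forall_finite {β : Type} [Finite β] {P : β → (ι → ZFSet.{u}) → Prop}
    (hP : ∀ b, AbsolutelyDefinable A (P b)) : AbsolutelyDefinable A fun v => ∀ b, P b v := by
  choose φ hφ using hP
  exact ⟨Formula.iInf φ, fun α v => by simp only [Formula.realize_iInf, hφ]⟩

/-- For a fixed external formula, satisfaction unfolds by recursion into quantifiers bounded by `v
k`. No internal satisfaction predicate is needed. -/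
theorem satisfies {α : Type} {n : ℕ} (φ : setLanguage.BoundedFormula α n) (k : ι) (σ : α → ι)
    (τ : Fin n → ι) : AbsolutelyDefinable A fun v =>
      Satisfies A φ (v k) (fun i => v (σ i)) (fun i => v (τ i)) := by
  have key : ∀ {ι : Type} {n : ℕ} (σ : α → ι) (τ : Fin n → ι) (v : ι → ZFSet.{u}) (s : α ⊕ Fin n),
      Sum.elim (fun i => v (σ i)) (fun i => v (τ i)) s = v (Sum.elim σ τ s) := by
    rintro ι n σ τ v (s | s) <;> rfl
  induction φ generalizing ι with
  | falsum => exact false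
  | equal s t =>
    simp only [Satisfies, key]
    exact eq _ _
  | rel R ts =>
    simp only [Satisfies, key]
    cases R
    · exact mem _ _
    · exact pred _
  | imp φ ψ ih₁ ih₂ => exact (ih₁ _ _ _).imp (ih₂ _ _ _)
  | @all n φ ih =>
    refine ball ?_
    refine (ih (Sum.inl k) (fun i => Sum.inl (σ i))
      (Fin.snoc (α := fun _ => ι ⊕ Unit) (fun i => Sum.inl (τ i)) (Sum.inr ()))).congr fun w => ?_
    have hs := Fin.comp_snoc (α := ι ⊕ Unit) w (fun i => Sum.inl (τ i)) (Sum.inr ())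
    simp only [Function.comp_def] at hs
    rw [hs]

end AbsolutelyDefinable

/-- The relation `e` from `v` to `v'` preserves the formula `φ`. -/
def Preserves (A : Class.{u}) {n : ℕ} (φ : setLanguage.Formula (Fin n)) (v v' e : ZFSet.{u}) :
    Prop :=
  ∀ x : Fin n ⊕ Fin n → ZFSet.{u}, (∀ i, pair (x (.inl i)) (x (.inr i)) ∈ e) →
    (Satisfies A φ v (fun i => x (.inl i)) default ↔ Satisfies A φ v' (fun i => x (.inr i)) default)

theorem AbsolutelyDefinable.preserves {A : Class.{u}} {ι : Type} {n : ℕ}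
    (φ : setLanguage.Formula (Fin n)) (i k l : ι) :
    AbsolutelyDefinable A fun v => Preserves A φ (v i) (v k) (v l) := by
  refine forall_of_rank_le (.imp (forall_finite fun _ => pair_mem _ _ _) (.iff ?_ ?_)) ?_
  · exact (satisfies φ (Sum.inl i) (fun k => Sum.inr (Sum.inl k)) Fin.elim0).congr fun v => by
      rw [Subsingleton.elim (fun i : Fin 0 => v (i.elim0)) default]
  · exact (satisfies φ (Sum.inl k) (fun k => Sum.inr (Sum.inr k)) Fin.elim0).congr fun v => by
      rw [Subsingleton.elim (fun i : Fin 0 => v (i.elim0)) default]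
  · intro v x h b
    have hx := (Classical.not_imp.1 h).1
    refine ⟨l, ?_⟩
    rcases b with b | b
    · exact (rank_left_lt_rank_pair _ _).le.trans (rank_lt_of_mem (hx b)).le
    · exact (rank_right_lt_rank_pair _ _).le.trans (rank_lt_of_mem (hx b)).le

/-! ### Codes of elementary embeddings. -/

/-- `c` is a triple `⟨v, v', e⟩`. -/
def IsTriple (c v v' e : ZFSet.{u}) : Prop := c = pair v (pair v' e)

theorem IsTriple.rank_le {c v v' e : ZFSet.{u}} (h : IsTriple c v v' e) :
    v.rank ≤ c.rank ∧ v'.rank ≤ c.rank ∧ e.rank ≤ c.rank := by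
  rw [h]
  have h₁ := rank_left_lt_rank_pair v (pair v' e)
  have h₂ := rank_right_lt_rank_pair v (pair v' e)
  exact ⟨h₁.le, ((rank_left_lt_rank_pair v' e).trans h₂).le,
    ((rank_right_lt_rank_pair v' e).trans h₂).le⟩

theorem IsTriple.eq {c v v' e w w' d : ZFSet.{u}} (h : IsTriple c v v' e)
    (h' : IsTriple c w w' d) : v = w ∧ v' = w' ∧ e = d := by
  simpa [IsTriple, pair_inj] using h.symm.trans h'

theorem AbsolutelyDefinable.isTriple {A : Class.{u}} {ι : Type} (i k l m : ι) :
    AbsolutelyDefinable A fun v => IsTriple (v i) (v k) (v l) (v m) :=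
  congr (P := fun v => ∃ p, p = pair (v l) (v m) ∧ v i = pair (v k) p)
    (.ex (.and (eq_pair _ _ _) (eq_pair _ _ _)) fun v p h =>
      ⟨i, by rw [h.2]; exact (rank_right_lt_rank_pair _ _).le⟩) fun v => by
    simp [IsTriple]

/-- `c = ⟨v, v', e⟩`, where `v` and `v'` are levels of the von Neumann hierarchy and `e` is a total
relation from `v` to `v'`. -/
def IsPreEmbedding (c : ZFSet.{u}) : Prop :=
  ∃ v v' e, IsTriple c v v' e ∧ (∃ α, v = V_ α) ∧ (∃ θ, v' = V_ θ) ∧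
    (∀ p ∈ e, ∃ a ∈ v, ∃ b ∈ v', p = pair a b) ∧ ∀ a ∈ v, ∃ b ∈ v', pair a b ∈ e

/-- The relation coded by `c` preserves the formula `φ`. -/
def CodePreserves (A : Class.{u}) {n : ℕ} (φ : setLanguage.Formula (Fin n)) (c : ZFSet.{u}) :
    Prop :=
  ∃ v v' e, IsTriple c v v' e ∧ Preserves A φ v v' e

/-- `c` codes an elementary embedding between two levels. -/
def IsEmbedding (A : Class.{u}) (c : ZFSet.{u}) : Prop :=
  IsPreEmbedding c ∧ ∀ {n : ℕ} (φ : setLanguage.Formula (Fin n)), CodePreserves A φ c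

namespace AbsolutelyDefinable

variable {A : Class.{u}} {ι : Type}

theorem ex_triple {P : (ι → ZFSet.{u}) → ZFSet.{u} → ZFSet.{u} → ZFSet.{u} → Prop} {i : ι}
    (hP : AbsolutelyDefinable A fun w : ((ι ⊕ Unit) ⊕ Unit) ⊕ Unit → ZFSet.{u} =>
      P (fun i => w (.inl (.inl (.inl i)))) (w (.inl (.inl (.inr ())))) (w (.inl (.inr ())))
        (w (.inr ()))) :
    AbsolutelyDefinable A fun v => ∃ x y z, IsTriple (v i) x y z ∧ P v x y z := by
  refine .ex (.ex (.ex (.and (isTriple _ _ _ _) hP) ?_) ?_) ?_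
  · rintro w z ⟨h, -⟩
    exact ⟨.inl (.inl i), h.rank_le.2.2⟩
  · rintro w y ⟨z, h, -⟩
    exact ⟨.inl i, h.rank_le.2.1⟩
  · rintro w x ⟨y, z, h, -⟩
    exact ⟨i, h.rank_le.1⟩

theorem isPreEmbedding (i : ι) : AbsolutelyDefinable A fun v => IsPreEmbedding (v i) :=
  .ex_triple (.and (eq_vonNeumann _) (.and (eq_vonNeumann _)
    (.and (.ball (.bex (.bex (eq_pair _ _ _)))) (.ball (.bex (pair_mem _ _ _))))))

theorem codePreserves {n : ℕ} (φ : setLanguage.Formula (Fin n)) (i : ι) :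
    AbsolutelyDefinable A fun v => CodePreserves A φ (v i) :=
  .ex_triple (preserves _ _ _ _)

end AbsolutelyDefinable

/-! ### Transfer along an elementary embedding. -/

/-- `J` maps `V_μ` into `V_θ` and preserves all absolutely definable predicates. -/
structure IsTransfer (A : Class.{u}) (μ θ : Ordinal.{u}) (J : ZFSet.{u} → ZFSet.{u}) : Prop where
  map_mem : ∀ x ∈ V_ μ, J x ∈ V_ θ
  map_iff : ∀ {ι : Type} {P : (ι → ZFSet.{u}) → Prop}, AbsolutelyDefinable A P →
    ∀ v, (∀ i, v i ∈ V_ μ) → (P v ↔ P fun i => J (v i))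

open Classical in
/-- An elementary embedding as a function on all sets. -/
noncomputable def extendMap {A : Class.{u}} {μ θ : Ordinal.{u}}
    (j : Level A μ ↪ₑ[setLanguage] Level A θ) (x : ZFSet.{u}) : ZFSet.{u} :=
  if h : x ∈ V_ μ then (j ⟨x, h⟩).1 else ∅

theorem extendMap_coe {A : Class.{u}} {μ θ : Ordinal.{u}}
    (j : Level A μ ↪ₑ[setLanguage] Level A θ) (x : Level A μ) : extendMap j x.1 = (j x).1 :=
  dif_pos x.2

theorem isTransfer_extendMap {A : Class.{u}} {μ θ : Ordinal.{u}}
    (j : Level A μ ↪ₑ[setLanguage] Level A θ) : IsTransfer A μ θ (extendMap j) where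
  map_mem x hx := (extendMap_coe j ⟨x, hx⟩) ▸ (j ⟨x, hx⟩).2
  map_iff := by
    rintro ι P ⟨φ, hφ⟩ v hv
    have h₁ := hφ μ fun i => ⟨v i, hv i⟩
    have h₂ := hφ θ (j ∘ fun i => ⟨v i, hv i⟩)
    refine (h₁.symm.trans ((j.map_formula φ _).symm.trans h₂)).trans
      (iff_of_eq (congrArg P (funext fun i => ?_)))
    exact (extendMap_coe j ⟨v i, hv i⟩).symm

instance : Countable setLanguage.Symbols := by
  have h₁ : Countable (Σ l, setLanguage.Functions l) :=
    have : IsEmpty (Σ l, setLanguage.Functions l) := ⟨fun x => Empty.elim x.2⟩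
    inferInstance
  have h₂ : ∀ l, Countable (setLanguage.Relations l) := fun l =>
    have : Subsingleton (SetRel l) := ⟨fun a b => by cases a <;> cases b <;> rfl⟩
    inferInstanceAs (Countable (SetRel l))
  exact inferInstanceAs (Countable ((Σ l, setLanguage.Functions l) ⊕ (Σ l, setLanguage.Relations l)))

/-- The graph of the restriction of `J` to `v`. -/
noncomputable def graphOn (J : ZFSet.{u} → ZFSet.{u}) (v : ZFSet.{u}) : ZFSet.{u} :=
  ZFSet.sep (fun p => ∃ a, p = pair a (J a)) (prod v (J v))

/-- The code of the restriction of `J` to `v`. -/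
noncomputable def restrictCode (J : ZFSet.{u} → ZFSet.{u}) (v : ZFSet.{u}) : ZFSet.{u} :=
  pair v (pair (J v) (graphOn J v))

theorem restrictCode_mem_vonNeumann {J : ZFSet.{u} → ZFSet.{u}} {v : ZFSet.{u}} {η : Ordinal.{u}}
    (hη : Order.IsSuccLimit η) (hv : v ∈ V_ η) (hJv : J v ∈ V_ η) : restrictCode J v ∈ V_ η := by
  refine pair_mem_vonNeumann hη hv (pair_mem_vonNeumann hη hJv ?_)
  obtain ⟨δ, hδ, h₁⟩ : ∃ δ < η, max v.rank (J v).rank ≤ δ :=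
    ⟨_, max_lt (mem_vonNeumann.1 hv) (mem_vonNeumann.1 hJv), le_rfl⟩
  rw [mem_vonNeumann]
  refine lt_of_le_of_lt (rank_le_iff.2 fun p hp => ?_) (hη.succ_lt (hη.succ_lt hδ))
  obtain ⟨hp, -⟩ := mem_sep.1 hp
  obtain ⟨a, ha, b, hb, rfl⟩ := mem_prod.1 hp
  have ha' := (rank_lt_of_mem ha).trans_le ((le_max_left _ _).trans h₁)
  have hb' := (rank_lt_of_mem hb).trans_le ((le_max_right _ _).trans h₁)
  rw [pair, rank_pair, rank_pair, rank_singleton]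
  have ha'' := Order.succ_lt_succ ha'
  exact max_lt (Order.succ_lt_succ ha'')
    (Order.succ_lt_succ (max_lt ha'' (Order.succ_lt_succ hb')))

theorem isTriple_restrictCode (J : ZFSet.{u} → ZFSet.{u}) (v : ZFSet.{u}) :
    IsTriple (restrictCode J v) v (J v) (graphOn J v) :=
  rfl

namespace IsTransfer

variable {A : Class.{u}} {μ θ : Ordinal.{u}} {J : ZFSet.{u} → ZFSet.{u}}

theorem map_iff₁ (hJ : IsTransfer A μ θ J) {P : ZFSet.{u} → Prop}
    (hP : AbsolutelyDefinable A fun v : Fin 1 → ZFSet.{u} => P (v 0)) {x : ZFSet.{u}}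
    (hx : x ∈ V_ μ) : P x ↔ P (J x) :=
  hJ.map_iff hP ![x] (by simp [hx])

theorem map_iff₂ (hJ : IsTransfer A μ θ J) {P : ZFSet.{u} → ZFSet.{u} → Prop}
    (hP : AbsolutelyDefinable A fun v : Fin 2 → ZFSet.{u} => P (v 0) (v 1)) {x y : ZFSet.{u}}
    (hx : x ∈ V_ μ) (hy : y ∈ V_ μ) : P x y ↔ P (J x) (J y) :=
  hJ.map_iff hP ![x, y] (by simp [Fin.forall_fin_succ, hx, hy])

theorem map_iff₃ (hJ : IsTransfer A μ θ J) {P : ZFSet.{u} → ZFSet.{u} → ZFSet.{u} → Prop}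
    (hP : AbsolutelyDefinable A fun v : Fin 3 → ZFSet.{u} => P (v 0) (v 1) (v 2))
    {x y z : ZFSet.{u}} (hx : x ∈ V_ μ) (hy : y ∈ V_ μ) (hz : z ∈ V_ μ) :
    P x y z ↔ P (J x) (J y) (J z) :=
  hJ.map_iff hP ![x, y, z] (by simp [Fin.forall_fin_succ, hx, hy, hz])

theorem map_iff₄ (hJ : IsTransfer A μ θ J)
    {P : ZFSet.{u} → ZFSet.{u} → ZFSet.{u} → ZFSet.{u} → Prop}
    (hP : AbsolutelyDefinable A fun v : Fin 4 → ZFSet.{u} => P (v 0) (v 1) (v 2) (v 3))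
    {x y z w : ZFSet.{u}} (hx : x ∈ V_ μ) (hy : y ∈ V_ μ) (hz : z ∈ V_ μ) (hw : w ∈ V_ μ) :
    P x y z w ↔ P (J x) (J y) (J z) (J w) :=
  hJ.map_iff hP ![x, y, z, w] (by simp [Fin.forall_fin_succ, hx, hy, hz, hw])

theorem mem_iff (hJ : IsTransfer A μ θ J) {x y : ZFSet.{u}} (hx : x ∈ V_ μ) (hy : y ∈ V_ μ) :
    x ∈ y ↔ J x ∈ J y :=
  hJ.map_iff₂ (P := fun x y => x ∈ y) (.mem _ _) hx hy

theorem map_vonNeumann (hJ : IsTransfer A μ θ J) {α : Ordinal.{u}} (hα : α < μ) :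
    ∃ β, J (V_ α) = V_ β :=
  (hJ.map_iff₁ (P := fun x => ∃ β, x = V_ β) (.eq_vonNeumann _) (by simpa)).1 ⟨α, rfl⟩

theorem pair_mem_graphOn (hJ : IsTransfer A μ θ J) {v : ZFSet.{u}} (hv : v ∈ V_ μ)
    {a b : ZFSet.{u}} :
    pair a b ∈ graphOn J v ↔ a ∈ v ∧ b = J a := by
  simp only [graphOn, mem_sep, pair_mem_prod, pair_inj]
  constructor
  · rintro ⟨⟨h, -⟩, a', rfl, rfl⟩
    exact ⟨h, rfl⟩
  · rintro ⟨h, rfl⟩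
    exact ⟨⟨h, (hJ.mem_iff (isTransitive_vonNeumann _ _ hv h) hv).1 h⟩, a, rfl, rfl⟩

/-- Being a level is absolute, so `J (V_ α)` is one. For each `φ`, satisfaction in `V_ α` is an
absolute predicate of `V_ α` and the parameters, so `J` carries it to satisfaction in `J (V_ α)`. -/
theorem isEmbedding_restrictCode (hJ : IsTransfer A μ θ J) {α : Ordinal.{u}} (hα : α < μ) :
    IsEmbedding A (restrictCode J (V_ α)) := by
  have hv : V_ α ∈ V_ μ := by simpa
  refine ⟨⟨_, _, _, isTriple_restrictCode _ _, ⟨α, rfl⟩, hJ.map_vonNeumann hα, fun p hp => ?_,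
    fun a ha => ?_⟩, fun {n} φ => ⟨_, _, _, isTriple_restrictCode _ _, fun x hx => ?_⟩⟩
  · exact mem_prod.1 (mem_sep.1 hp).1
  · exact ⟨J a, (hJ.mem_iff (isTransitive_vonNeumann _ _ hv ha) hv).1 ha,
      (hJ.pair_mem_graphOn hv).2 ⟨ha, rfl⟩⟩
  · simp only [hJ.pair_mem_graphOn hv] at hx
    have h := hJ.map_iff (ι := Option (Fin n)) (.satisfies φ none some Fin.elim0)
      (fun i => i.elim (V_ α) fun i => x (.inl i)) (by
        rintro (_ | i)
        · exact hv
        · exact isTransitive_vonNeumann _ _ hv (hx i).1)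
    simp only [Option.elim] at h
    simp only [(hx _).2]
    convert h using 2

/-- The codes of elementary embeddings in a limit level are mapped to the codes of elementary
embeddings in the image of this level. -/
theorem mem_map_embeddings_iff (hJ : IsTransfer A μ θ J) {η : Ordinal.{u}}
    (hη : Order.IsSuccLimit η) (hω : Ordinal.omega0 < η) (hμ : η < μ)
    (hfix : ∀ β ≤ Ordinal.omega0, J β.toZFSet = β.toZFSet) (c : ZFSet.{u}) :
    c ∈ J (ZFSet.sep (IsEmbedding A) (V_ η)) ↔ c ∈ J (V_ η) ∧ IsEmbedding A c := by
  set W := ZFSet.sep (IsEmbedding A) (V_ η) with hW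
  have hηm : V_ η ∈ V_ μ := by simpa
  have hWm : W ∈ V_ μ := mem_vonNeumann_of_subset sep_subset hηm
  have hωm : (Ordinal.omega0.{u}).toZFSet ∈ V_ μ := by
    rw [mem_vonNeumann, Ordinal.rank_toZFSet]; exact hω.trans hμ
  have hnη : ∀ n : ℕ, (n : Ordinal.{u}).toZFSet ∈ V_ η := fun n => by
    rw [mem_vonNeumann, Ordinal.rank_toZFSet]; exact (Ordinal.natCast_lt_omega0 n).trans hω
  have hnm : ∀ n : ℕ, (n : Ordinal.{u}).toZFSet ∈ V_ μ := fun n =>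
    isTransitive_vonNeumann _ _ hηm (hnη n)
  constructor
  · intro hc
    refine ⟨(hJ.map_iff₂ (P := fun x y => x ⊆ y) (.subset _ _) hWm hηm).1 sep_subset hc, ?_, ?_⟩
    · exact (hJ.map_iff₁ (P := fun x => ∀ c ∈ x, IsPreEmbedding c) (.ball (.isPreEmbedding _))
        hWm).1 (fun c hc => (mem_sep.1 hc).2.1) c hc
    · intro n φ
      exact (hJ.map_iff₁ (P := fun x => ∀ c ∈ x, CodePreserves A φ c) (.ball (.codePreserves _ _))
        hWm).1 (fun c hc => (mem_sep.1 hc).2.2 φ) c hc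
  · rintro ⟨hc, hpre, hpres⟩
    have : Nonempty (Σ n, setLanguage.Formula (Fin n)) := ⟨⟨0, ⊥⟩⟩
    have : ∀ n, Countable (setLanguage.Formula (Fin n)) := fun n => inferInstance
    obtain ⟨F, hF⟩ := exists_surjective_nat (Σ n, setLanguage.Formula (Fin n))
    -- `N` records the numbers of the formulas that a code fails to preserve. It turns the infinite
    -- conjunction in `IsEmbedding` into a statement with `N` and `ω` as parameters.
    set N := ZFSet.sep (fun p => ∃ (n : ℕ) (d : ZFSet.{u}), p = pair (n : Ordinal.{u}).toZFSet d ∧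
      ¬ CodePreserves A (F n).2 d) (V_ η)
    have hNm : N ∈ V_ μ := mem_vonNeumann_of_subset sep_subset hηm
    have h₁ := (hJ.map_iff₄ (P := fun x w o m => ∀ c ∈ x, IsPreEmbedding c →
      c ∈ w ∨ ∃ n ∈ o, pair n c ∈ m) (.ball (.imp (.isPreEmbedding _)
        (.or (.mem _ _) (.bex (.pair_mem _ _ _))))) hηm hWm hωm hNm).1 (by
      intro c hc hpre
      by_cases he : IsEmbedding A c
      · exact .inl (mem_sep.2 ⟨hc, he⟩)
      · right
        have : ∃ (n : ℕ) (φ : setLanguage.Formula (Fin n)), ¬ CodePreserves A φ c := by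
          by_contra! h
          exact he ⟨hpre, fun φ => h _ φ⟩
        obtain ⟨n, φ, hφ⟩ := this
        obtain ⟨m, hm⟩ := hF ⟨n, φ⟩
        refine ⟨(m : Ordinal.{u}).toZFSet, ?_, mem_sep.2 ⟨pair_mem_vonNeumann hη (hnη m) hc, m, c,
          rfl, ?_⟩⟩
        · rw [Ordinal.toZFSet_mem_toZFSet_iff]
          exact Ordinal.natCast_lt_omega0 m
        · rw [hm]
          exact hφ) c hc hpre
    rcases h₁ with h₁ | ⟨n, hn, hnc⟩
    · exact h₁
    -- Since `J` fixes `ω` and its elements, the index found in `J(ω)` is a true natural number and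
    -- still denotes the same formula.
    rw [hfix _ le_rfl, Ordinal.mem_toZFSet_iff] at hn
    obtain ⟨β, hβ, rfl⟩ := hn
    obtain ⟨m, rfl⟩ := Ordinal.lt_omega0.1 hβ
    have h₂ := (hJ.map_iff₃ (P := fun n m x => ∀ c ∈ x, pair n c ∈ m → ¬ CodePreserves A (F _).2 c)
      (.ball (.imp (.pair_mem _ _ _) (.not (.codePreserves _ _)))) (hnm m) hNm hηm).1 (by
      intro c _ hc
      obtain ⟨m', d, h, hd⟩ := (mem_sep.1 hc).2
      obtain ⟨hmm, rfl⟩ := pair_inj.1 h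
      obtain rfl : m = m' := by exact_mod_cast Ordinal.toZFSet_injective hmm
      exact hd) c hc (by rwa [hfix _ hβ.le])
    exact absurd (hpres _) h₂

end IsTransfer

/-- The elementary embedding with a given code. -/
theorem IsEmbedding.exists_elementaryEmbedding {A : Class.{u}} {c : ZFSet.{u}}
    (hc : IsEmbedding A c) : ∃ (α θ : Ordinal.{u}) (j : Level A α ↪ₑ[setLanguage] Level A θ)
      (e : ZFSet.{u}), IsTriple c (V_ α) (V_ θ) e ∧
        ∀ (x : Level A α) (y : ZFSet.{u}), pair x.1 y ∈ e ↔ y = (j x).1 := by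
  obtain ⟨⟨_, _, e, ht, ⟨α, rfl⟩, ⟨θ, rfl⟩, he, htot⟩, hpres⟩ := hc
  have hp : ∀ {n : ℕ} (φ : setLanguage.Formula (Fin n)) (x : Fin n → Level A α)
      (y : Fin n → Level A θ), (∀ i, pair (x i).1 (y i).1 ∈ e) → (φ.Realize x ↔ φ.Realize y) := by
    intro n φ x y h
    obtain ⟨_, _, _, ht', hφ⟩ := hpres φ
    obtain ⟨rfl, rfl, rfl⟩ := ht.eq ht'
    have := hφ (Sum.elim (fun i => (x i).1) (fun i => (y i).1)) h
    have h₁ := satisfies_vonNeumann φ x default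
    have h₂ := satisfies_vonNeumann φ y default
    rw [Formula.Realize, Formula.Realize, ← h₁, ← h₂]
    simp only [Sum.elim_inl, Sum.elim_inr] at this
    convert this using 2
  -- Single-valuedness is not part of `IsPreEmbedding`; it follows from preservation of the formula
  -- `x₀ = x₁`.
  have hfun : ∀ a b b', pair a b ∈ e → pair a b' ∈ e → b = b' := by
    intro a b b' h h'
    obtain ⟨a₁, ha, b₁, hb, h₁⟩ := he _ h
    obtain ⟨rfl, rfl⟩ := pair_inj.1 h₁
    obtain ⟨a₁, ha, b₁, hb', h₁⟩ := he _ h'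
    obtain ⟨rfl, rfl⟩ := pair_inj.1 h₁
    have := (hp (Term.equal (Term.var 0) (Term.var 1)) ![⟨a, ha⟩, ⟨a, ha⟩] ![⟨b, hb⟩, ⟨b', hb'⟩]
      (by simp [Fin.forall_fin_succ, h, h'])).1 (Formula.realize_equal.2 rfl)
    have := Formula.realize_equal.1 this
    exact congrArg (fun x : Level A θ => x.1) this
  choose f hf hfe using htot
  refine ⟨α, θ, ⟨fun x => ⟨f x.1 x.2, hf _ _⟩, fun n φ x => (hp φ x _ fun i => hfe _ _).symm⟩, e, ht,
    fun x y => ⟨fun h => hfun _ _ _ h (hfe _ _), fun h => h ▸ hfe _ _⟩⟩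

/-! ### Absoluteness of stretching and coherence. -/

/-- The embedding coded by `c = ⟨v, v', e⟩` has domain `V_l`, fixes the elements of `γ`, maps `γ`
above `l`, and the image of `x` intersects `l` in `h`. -/
def IsStretch (c γ x l h : ZFSet.{u}) : Prop :=
  ∃ v v' e, IsTriple c v v' e ∧ (l ∉ v ∧ ∀ β ∈ l, β ∈ v) ∧ (∀ β ∈ γ, pair β β ∈ e) ∧
    ∃ y z, pair γ y ∈ e ∧ l ∈ y ∧ pair x z ∈ e ∧ h = z ∩ l

theorem AbsolutelyDefinable.isStretch {A : Class.{u}} {ι : Type} (i k l m n : ι) :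
    AbsolutelyDefinable A fun v => IsStretch (v i) (v k) (v l) (v m) (v n) := by
  refine .ex_triple (.and (.and (.not (mem _ _)) (.ball (mem _ _))) (.and
    (.ball (pair_mem _ _ _)) (.ex (.ex (.and (pair_mem _ _ _) (.and (mem _ _)
      (.and (pair_mem _ _ _) (eq_inter _ _ _)))) ?_) ?_)))
  · rintro w z ⟨-, -, h, -⟩
    exact ⟨.inl (.inr ()), ((rank_right_lt_rank_pair _ _).trans (rank_lt_of_mem h)).le⟩
  · rintro w y ⟨z, h, -⟩
    exact ⟨.inr (), ((rank_right_lt_rank_pair _ _).trans (rank_lt_of_mem h)).le⟩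

/-- At each `γ < κ` closed under `f`, the pair `(f(γ), g ∩ f(γ))` is not realised by any code in
`W`, whereas all pairs with first component below `f(γ)` are. -/
def IsCoherent (κ g f W : ZFSet.{u}) : Prop :=
  ∀ γ ∈ κ, (∀ β ∈ γ, ∀ y ∈ κ, pair β y ∈ f → y ⊆ γ) →
    (∀ y ∈ κ, pair γ y ∈ f → ∀ x, x = g ∩ γ → ∀ h, h = g ∩ y → ∀ c ∈ W, ¬ IsStretch c γ x y h) ∧
    ∀ l ∈ κ, γ ∈ l → (∃ y ∈ κ, pair γ y ∈ f ∧ γ ∈ y ∧ (y ∈ l ∨ y = l)) ∨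
      ∀ x, x = g ∩ γ → ∀ h, h ⊆ l → x = h ∩ γ → ∃ c ∈ W, IsStretch c γ x l h

theorem AbsolutelyDefinable.isCoherent {A : Class.{u}} {ι : Type} (i k l m : ι) :
    AbsolutelyDefinable A fun v => IsCoherent (v i) (v k) (v l) (v m) := by
  refine .ball (.imp (.ball (.ball (.imp (pair_mem _ _ _) (subset _ _)))) (.and
    (.ball (.imp (pair_mem _ _ _) (.all (.imp (eq_inter _ _ _) (.all (.imp (eq_inter _ _ _)
      (.ball (.not (isStretch _ _ _ _ _)))) ?_)) ?_)))
    (.ball (.imp (mem _ _) (.or (.bex (.and (pair_mem _ _ _) (.and (mem _ _)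
      (.or (mem _ _) (eq _ _))))) (.all (.imp (eq_inter _ _ _) (.all (.imp (subset _ _)
        (.imp (eq_inter _ _ _) (.bex (isStretch _ _ _ _ _)))) ?_)) ?_))))))
  · intro v h hn
    refine ⟨.inl (.inl (.inl k)), ?_⟩
    rw [(Classical.not_imp.1 hn).1]
    exact rank_mono fun z hz => (mem_inter.1 hz).1
  · intro v h hn
    refine ⟨.inl (.inl k), ?_⟩
    rw [(Classical.not_imp.1 hn).1]
    exact rank_mono fun z hz => (mem_inter.1 hz).1
  · intro v h hn
    exact ⟨.inl (.inr ()), rank_mono (Classical.not_imp.1 hn).1⟩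
  · intro v h hn
    refine ⟨.inl (.inl k), ?_⟩
    rw [(Classical.not_imp.1 hn).1]
    exact rank_mono fun z hz => (mem_inter.1 hz).1

/-! ### Recursive construction of `g`. -/

open Set in
/-- A set of ordinals which at each stage `γ`, not overshot by earlier stages, copies the prescribed
extension `H` of its initial segment up to `L`. -/
theorem exists_set_of_prescription (L : Ordinal.{u} → Set Ordinal.{u} → Ordinal.{u})
    (H : Ordinal.{u} → Set Ordinal.{u} → Set Ordinal.{u})
    (hH : ∀ γ x, x ⊆ Iio γ → H γ x ∩ Iio γ = x) :
    ∃ g : Set Ordinal.{u}, ∀ γ, (∀ β < γ, L β (g ∩ Iio β) ≤ γ) →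
      g ∩ Iio (L γ (g ∩ Iio γ)) = H γ (g ∩ Iio γ) ∩ Iio (L γ (g ∩ Iio γ)) := by
  let step : ∀ α : Ordinal.{u}, (∀ β, β < α → Prop) → Prop := fun α ih =>
    ∃ γ ≤ α, (∀ β < γ, L β ({δ | ∃ h : δ < α, ih δ h} ∩ Iio β) ≤ γ) ∧
      α < L γ ({δ | ∃ h : δ < α, ih δ h} ∩ Iio γ) ∧ α ∈ H γ ({δ | ∃ h : δ < α, ih δ h} ∩ Iio γ)
  let g : Set Ordinal.{u} := {α | (wellFounded_lt (α := Ordinal.{u})).fix step α}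
  have hg : ∀ α, α ∈ g ↔ ∃ γ ≤ α, (∀ β < γ, L β (g ∩ Iio β) ≤ γ) ∧
      α < L γ (g ∩ Iio γ) ∧ α ∈ H γ (g ∩ Iio γ) := by
    intro α
    have h₁ : ∀ γ ≤ α, {δ | ∃ _ : δ < α, (wellFounded_lt (α := Ordinal.{u})).fix step δ} ∩ Iio γ =
        g ∩ Iio γ := by
      intro γ hγ
      ext δ
      simp only [mem_inter_iff, mem_ofPred_eq, mem_Iio, exists_prop, g]
      exact ⟨fun h => ⟨h.1.2, h.2⟩, fun h => ⟨⟨h.2.trans_le hγ, h.1⟩, h.2⟩⟩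
    have h₂ : α ∈ g ↔ step α fun δ _ => (wellFounded_lt (α := Ordinal.{u})).fix step δ := by
      exact iff_of_eq (WellFounded.fix_eq (wellFounded_lt (α := Ordinal.{u})) step α)
    rw [h₂]
    refine exists_congr fun γ => and_congr_right fun hγ => ?_
    rw [h₁ γ hγ]
    refine and_congr_left fun _ => forall₂_congr fun β hβ => ?_
    rw [h₁ β (hβ.le.trans hγ)]
  refine ⟨g, fun γ hγ => ?_⟩
  ext α
  simp only [mem_inter_iff, mem_Iio]
  refine and_congr_left fun hα => ?_
  rcases lt_or_ge α γ with h | h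
  · have := Set.ext_iff.1 (hH γ (g ∩ Iio γ) inter_subset_right) α
    simp only [mem_inter_iff, mem_Iio, h, and_true] at this
    exact this.symm
  · rw [hg]
    constructor
    -- The stage governing `α` is unique: an earlier one stops copying by `γ ≤ α`, and a later one
    -- starts only at or after `L γ`, which exceeds `α`.
    · rintro ⟨δ, hδ, hδc, hαδ, hαH⟩
      rcases lt_trichotomy δ γ with h' | rfl | h'
      · exact absurd (hαδ.trans_le (hγ δ h')) h.not_gt
      · exact hαH
      · exact absurd (hα.trans_le (hδc γ h')) hδ.not_gt
    · exact fun h' => ⟨γ, h, hγ, hα, h'⟩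

/-- The set of von Neumann ordinals below `α` corresponding to a set of ordinals. -/
noncomputable def ordinalSet (α : Ordinal.{u}) (s : Set Ordinal.{u}) : ZFSet.{u} :=
  ZFSet.sep (fun x => ∃ β ∈ s, x = β.toZFSet) α.toZFSet

theorem mem_ordinalSet {α : Ordinal.{u}} {s : Set Ordinal.{u}} {x : ZFSet.{u}} :
    x ∈ ordinalSet α s ↔ ∃ β ∈ s, β < α ∧ x = β.toZFSet := by
  simp only [ordinalSet, mem_sep, Ordinal.mem_toZFSet_iff]
  constructor
  · rintro ⟨⟨γ, hγ, rfl⟩, β, hβ, h⟩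
    obtain rfl := Ordinal.toZFSet_injective h
    exact ⟨γ, hβ, hγ, rfl⟩
  · rintro ⟨β, hβ, h, rfl⟩
    exact ⟨⟨β, h, rfl⟩, β, hβ, rfl⟩

theorem toZFSet_mem_ordinalSet {α β : Ordinal.{u}} {s : Set Ordinal.{u}} :
    β.toZFSet ∈ ordinalSet α s ↔ β ∈ s ∧ β < α := by
  rw [mem_ordinalSet]
  constructor
  · rintro ⟨γ, hγ, h, h'⟩
    obtain rfl := Ordinal.toZFSet_injective h'
    exact ⟨hγ, h⟩
  · exact fun h => ⟨β, h.1, h.2, rfl⟩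

theorem ext_of_subset_toZFSet {α : Ordinal.{u}} {x y : ZFSet.{u}} (hx : x ⊆ α.toZFSet)
    (hy : y ⊆ α.toZFSet) (h : ∀ β < α, β.toZFSet ∈ x ↔ β.toZFSet ∈ y) : x = y := by
  ext z
  constructor <;> intro hz
  · obtain ⟨β, hβ, rfl⟩ := Ordinal.mem_toZFSet_iff.1 (hx hz)
    exact (h β hβ).1 hz
  · obtain ⟨β, hβ, rfl⟩ := Ordinal.mem_toZFSet_iff.1 (hy hz)
    exact (h β hβ).2 hz

open Set in
/-- Bookkeeping along `κ`: for a notion of failure of `(l, h)` for `(γ, x)`, where `h ⊆ l` extends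
`x ⊆ γ`, there is `g ⊆ κ` which at closed stages `γ` copies a failure with least `l = f(γ)`. -/
theorem exists_bookkeeping (κ : Ordinal.{u})
    (Fails : Ordinal.{u} → ZFSet.{u} → Ordinal.{u} → ZFSet.{u} → Prop)
    (hF : ∀ γ x l h, Fails γ x l h → γ < l ∧ h ⊆ l.toZFSet ∧ h ∩ γ.toZFSet = x) :
    ∃ g f : ZFSet.{u}, g ⊆ κ.toZFSet ∧ f ⊆ prod κ.toZFSet κ.toZFSet ∧
      (∀ β < κ, ∃ δ < κ, ∀ y, pair β.toZFSet y ∈ f → y ⊆ δ.toZFSet) ∧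
      ∀ γ < κ, (∀ β < γ, ∀ y < κ, pair β.toZFSet y.toZFSet ∈ f → y ≤ γ) →
        (∀ l < κ, pair γ.toZFSet l.toZFSet ∈ f →
          Fails γ (g ∩ γ.toZFSet) l (g ∩ l.toZFSet)) ∧
        ∀ l < κ, (∀ y ≤ l, γ < y → pair γ.toZFSet y.toZFSet ∉ f) →
          ∀ h, ¬ Fails γ (g ∩ γ.toZFSet) l h := by
  have hex : ∀ (γ : Ordinal.{u}) (s : Set Ordinal.{u}), ∃ (l : Ordinal.{u}) (H : Set Ordinal.{u}),
      (s ⊆ Iio γ → H ∩ Iio γ = s) ∧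
      ((∃ l < κ, ∃ h, Fails γ (ordinalSet γ s) l h) → l < κ ∧
        Fails γ (ordinalSet γ s) l (ordinalSet l H) ∧
        ∀ l' < l, ∀ h, ¬ Fails γ (ordinalSet γ s) l' h) ∧
      (¬ (∃ l < κ, ∃ h, Fails γ (ordinalSet γ s) l h) → l = 0) := by
    intro γ s
    by_cases hS : ∃ l < κ, ∃ h, Fails γ (ordinalSet γ s) l h
    · obtain ⟨l, ⟨hl, h, hh⟩, hmin⟩ := WellFounded.has_min (wellFounded_lt (α := Ordinal.{u}))
        {l | l < κ ∧ ∃ h, Fails γ (ordinalSet γ s) l h} hS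
      obtain ⟨hγl, hhl, hhγ⟩ := hF _ _ _ _ hh
      refine ⟨l, {β | β.toZFSet ∈ h}, fun hs => ?_, fun _ => ⟨hl, ?_, fun l' hl' h' hf => ?_⟩,
        fun h' => absurd hS h'⟩
      · ext β
        have h₁ : β.toZFSet ∈ h ∩ γ.toZFSet ↔ β.toZFSet ∈ ordinalSet γ s := by rw [hhγ]
        rw [ZFSet.mem_inter, Ordinal.toZFSet_mem_toZFSet_iff, toZFSet_mem_ordinalSet] at h₁
        exact h₁.trans (and_iff_left_of_imp fun h => hs h)
      · have : ordinalSet l {β | β.toZFSet ∈ h} = h :=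
          ext_of_subset_toZFSet ZFSet.sep_subset hhl fun β hβ => by
            simp [toZFSet_mem_ordinalSet, hβ]
        rwa [this]
      · exact hmin l' ⟨hl'.trans hl, h', hf⟩ hl'
    -- Without a failure the length is `0`, so the stage copies nothing and never obstructs the
    -- closure of later stages.
    · exact ⟨0, s, fun hs => inter_eq_left.2 hs, fun h => absurd h hS, fun _ => rfl⟩
  choose L H hH hpos hneg using hex
  obtain ⟨g, hg⟩ := exists_set_of_prescription L H hH
  have hgγ : ∀ γ ≤ κ, ordinalSet γ (g ∩ Iio γ) = ordinalSet κ g ∩ γ.toZFSet := fun γ hγ =>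
    ext_of_subset_toZFSet (α := γ) ZFSet.sep_subset (fun z hz => (ZFSet.mem_inter.1 hz).2)
      fun β hβ => by
        simp [toZFSet_mem_ordinalSet, hβ, hβ.trans_le hγ]
  -- Only stages with a failure enter `f`; the default length `0` is not recorded.
  set f := ZFSet.sep (fun p => ∃ γ : Ordinal.{u}, p = pair γ.toZFSet (L γ (g ∩ Iio γ)).toZFSet ∧
      ∃ l < κ, ∃ h, Fails γ (ordinalSet γ (g ∩ Iio γ)) l h)
    (prod κ.toZFSet κ.toZFSet) with hf
  have hmemf : ∀ γ < κ, ∀ y, pair γ.toZFSet y ∈ f ↔ y = (L γ (g ∩ Iio γ)).toZFSet ∧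
      ∃ l < κ, ∃ h, Fails γ (ordinalSet γ (g ∩ Iio γ)) l h := by
    intro γ hγ y
    simp only [hf, ZFSet.mem_sep, pair_mem_prod, pair_inj]
    constructor
    · rintro ⟨-, δ, ⟨h₁, h₂⟩, h₃⟩
      obtain rfl := Ordinal.toZFSet_injective h₁
      exact ⟨h₂, h₃⟩
    · rintro ⟨rfl, h⟩
      exact ⟨⟨Ordinal.toZFSet_mem_toZFSet_iff.2 hγ,
        Ordinal.toZFSet_mem_toZFSet_iff.2 (hpos _ _ h).1⟩, γ, ⟨rfl, rfl⟩, h⟩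
  refine ⟨ordinalSet κ g, f, ZFSet.sep_subset, ZFSet.sep_subset, fun β hβ => ?_,
    fun γ hγ hcl => ⟨fun l hl hlf => ?_, fun l hl hlf h hh => ?_⟩⟩
  · by_cases h : ∃ l < κ, ∃ h, Fails β (ordinalSet β (g ∩ Iio β)) l h
    · refine ⟨_, (hpos _ _ h).1, fun y hy => ?_⟩
      rw [((hmemf β hβ y).1 hy).1]
    · exact ⟨β, hβ, fun y hy => absurd ((hmemf β hβ y).1 hy).2 h⟩
  · obtain ⟨h₁, h₂⟩ := (hmemf γ hγ _).1 hlf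
    obtain rfl := Ordinal.toZFSet_injective h₁
    have h₃ := (hpos _ _ h₂).2.1
    have hcl' : ∀ β < γ, L β (g ∩ Iio β) ≤ γ := by
      intro β hβ
      by_cases h : ∃ l < κ, ∃ h, Fails β (ordinalSet β (g ∩ Iio β)) l h
      · exact hcl β hβ _ (hpos _ _ h).1 ((hmemf β (hβ.trans hγ) _).2 ⟨rfl, h⟩)
      · rw [hneg _ _ h]
        exact zero_le
    have h₄ : ordinalSet (L γ (g ∩ Iio γ)) (H γ (g ∩ Iio γ)) =
        ordinalSet κ g ∩ (L γ (g ∩ Iio γ)).toZFSet := by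
      rw [← hgγ _ hl.le, hg γ hcl']
      exact ext_of_subset_toZFSet ZFSet.sep_subset ZFSet.sep_subset fun β hβ => by
        simp [toZFSet_mem_ordinalSet, hβ]
    rwa [← hgγ _ hγ.le, ← h₄]
  · rw [← hgγ _ hγ.le] at hh
    have h₁ := hpos γ (g ∩ Iio γ) ⟨l, hl, h, hh⟩
    refine hlf (L γ (g ∩ Iio γ)) ?_ (hF _ _ _ _ h₁.2.1).1 ((hmemf γ hγ _).2 ⟨rfl, l, hl, h, hh⟩)
    by_contra! hlt
    exact h₁.2.2 l hlt h hh

/-! ### Decoding embeddings, uncountability of `κ`, and coherence of `g`. -/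

theorem toZFSet_mem_vonNeumann {α β : Ordinal.{u}} : α.toZFSet ∈ V_ β ↔ α < β := by
  rw [mem_vonNeumann, Ordinal.rank_toZFSet]

theorem eq_of_toZFSet_mem_vonNeumann_iff {α l : Ordinal.{u}} (h₁ : l.toZFSet ∉ V_ α)
    (h₂ : ∀ β ∈ l.toZFSet, β ∈ V_ α) : α = l := by
  rw [toZFSet_mem_vonNeumann, not_lt] at h₁
  refine h₁.eq_of_not_lt fun h => ?_
  exact lt_irrefl _ (toZFSet_mem_vonNeumann.1 (h₂ _ (Ordinal.toZFSet_mem_toZFSet_iff.2 h)))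

/-- A code with the stretching property yields an extendibility embedding. -/
theorem exists_isExtendibilityEmbedding {A : Class.{u}} {κ l : Ordinal.{u}} (hκ : κ < l)
    {g h c : ZFSet.{u}} (hg : g ⊆ κ.toZFSet) (hc : IsEmbedding A c)
    (hs : IsStretch c κ.toZFSet g l.toZFSet h) :
    ∃ (θ : Ordinal.{u}) (j : Level A l ↪ₑ[setLanguage] Level A θ),
      IsExtendibilityEmbedding hκ j ∧ (j (Level.ofSubset A hκ g hg)).1 ∩ l.toZFSet = h := by
  obtain ⟨α, θ, j, e, ht, he⟩ := hc.exists_elementaryEmbedding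
  obtain ⟨_, _, _, ht', ⟨h₁, h₂⟩, hfix, y, z, hy, hly, hz, rfl⟩ := hs
  obtain ⟨rfl, rfl, rfl⟩ := ht.eq ht'
  obtain rfl := eq_of_toZFSet_mem_vonNeumann_iff h₁ h₂
  obtain rfl := (he (Level.ofOrdinal A hκ) y).1 hy
  obtain rfl := (he (Level.ofSubset A hκ g hg) z).1 hz
  refine ⟨θ, j, ⟨⟨⟨hκ, fun h => ?_⟩, fun β hβ hβκ => ?_⟩, hly⟩, rfl⟩
  · rw [h, Ordinal.toZFSet_mem_toZFSet_iff] at hly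
    exact hly.not_gt hκ
  · exact ((he (Level.ofOrdinal A hβ) _).1
      (hfix _ (Ordinal.toZFSet_mem_toZFSet_iff.2 hβκ))).symm

/-- Every element of `κ ≤ ω` is empty or the successor of an element of `κ`. This passes to `J(κ)`,
and `∈`-induction then leaves only natural numbers. -/
theorem mem_omega_of_mem_map {A : Class.{u}} {μ θ : Ordinal.{u}} {J : ZFSet.{u} → ZFSet.{u}}
    (hJ : IsTransfer A μ θ J) {κ : Ordinal.{u}} (hκ : κ ≤ Ordinal.omega0) (hμ : κ < μ) :
    ∀ y ∈ J κ.toZFSet, ∃ n : ℕ, y = (n : Ordinal.{u}).toZFSet := by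
  have h := (hJ.map_iff₁ (P := fun x => ∀ y ∈ x, y = ∅ ∨ ∃ z ∈ x, y = insert z z)
    (.ball (.or (.eq_empty _) (.bex (.eq_succ _ _)))) (toZFSet_mem_vonNeumann.2 hμ)).1 (by
    intro y hy
    obtain ⟨β, hβ, rfl⟩ := Ordinal.mem_toZFSet_iff.1 hy
    obtain ⟨n, rfl⟩ := Ordinal.lt_omega0.1 (hβ.trans_le hκ)
    cases n with
    | zero => simp
    | succ n =>
      refine .inr ⟨(n : Ordinal.{u}).toZFSet, ?_, by simp⟩
      rw [Ordinal.toZFSet_mem_toZFSet_iff]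
      exact lt_of_le_of_lt (by exact_mod_cast n.le_succ) hβ)
  intro y
  induction y using ZFSet.inductionOn with
  | _ y ih =>
    intro hy
    rcases h y hy with rfl | ⟨z, hz, rfl⟩
    · exact ⟨0, by simp⟩
    · obtain ⟨n, rfl⟩ := ih z (mem_insert _ _) hz
      exact ⟨n + 1, by simp⟩

/-- Otherwise an embedding of degree `ω + 1` would put `ω + 1` into `j(κ)`, whose elements are
natural numbers. The bound ensures that embeddings with critical point `κ` fix `ω`. -/
theorem IsExtendible.omega0_lt {A : Class.{u}} {κ : Cardinal.{u}} (hκ : IsExtendible A κ) :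
    Ordinal.omega0 < κ.ord := by
  by_contra! h
  have hlt : κ.ord < Order.succ Ordinal.omega0 := h.trans_lt (Order.lt_succ _)
  obtain ⟨θ, j, -, hj⟩ := hκ (Order.succ Ordinal.omega0) hlt
  have h₁ := mem_omega_of_mem_map (isTransfer_extendMap j) h hlt (Order.succ Ordinal.omega0).toZFSet
    (by rwa [show extendMap j κ.ord.toZFSet = _ from extendMap_coe j (Level.ofOrdinal A hlt)])
  obtain ⟨n, hn⟩ := h₁
  have := Ordinal.toZFSet_injective hn
  exact ((Ordinal.natCast_lt_omega0 n).trans (Order.lt_succ _)).ne this.symm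

/-- All codes realising something in `V_κ` can be found in a fixed level. -/
theorem exists_bound_of_stretch (A : Class.{u}) (κ : Ordinal.{u}) : ∃ η : Ordinal.{u},
    ∀ γ ∈ V_ κ, ∀ x ∈ V_ κ, ∀ l ∈ V_ κ, ∀ h ∈ V_ κ,
      (∃ c, IsEmbedding A c ∧ IsStretch c γ x l h) →
        ∃ c ∈ V_ η, IsEmbedding A c ∧ IsStretch c γ x l h := by
  have : ∀ t : V_ κ × V_ κ × V_ κ × V_ κ, ∃ c,
      (∃ c, IsEmbedding A c ∧ IsStretch c t.1.1 t.2.1.1 t.2.2.1.1 t.2.2.2.1) →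
        IsEmbedding A c ∧ IsStretch c t.1.1 t.2.1.1 t.2.2.1.1 t.2.2.2.1 := by
    intro t
    by_cases h : ∃ c, IsEmbedding A c ∧ IsStretch c t.1.1 t.2.1.1 t.2.2.1.1 t.2.2.2.1
    · exact ⟨_, fun _ => h.choose_spec⟩
    · exact ⟨∅, fun h' => absurd h' h⟩
  choose F hF using this
  refine ⟨(ZFSet.range F).rank, fun γ hγ x hx l hl h hh hc => ?_⟩
  refine ⟨F (⟨γ, hγ⟩, ⟨x, hx⟩, ⟨l, hl⟩, ⟨h, hh⟩), ?_, hF (⟨γ, hγ⟩, ⟨x, hx⟩, ⟨l, hl⟩, ⟨h, hh⟩) hc⟩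
  exact mem_vonNeumann.2 (rank_lt_of_mem (mem_range_self _))

/-- The choice of `η` lets quantification over all codes be replaced by quantification over the set
of codes in `V_ η`, which can be mapped by `J`. -/
theorem isCoherent_of_bookkeeping {A : Class.{u}} {κ η : Ordinal.{u}} {g f : ZFSet.{u}}
    (hη : ∀ γ ∈ V_ κ, ∀ x ∈ V_ κ, ∀ l ∈ V_ κ, ∀ h ∈ V_ κ,
      (∃ c, IsEmbedding A c ∧ IsStretch c γ x l h) →
        ∃ c ∈ V_ η, IsEmbedding A c ∧ IsStretch c γ x l h)
    (hbook : ∀ γ < κ, (∀ β < γ, ∀ y < κ, pair β.toZFSet y.toZFSet ∈ f → y ≤ γ) →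
      (∀ l < κ, pair γ.toZFSet l.toZFSet ∈ f → ∀ c, IsEmbedding A c →
        ¬ IsStretch c γ.toZFSet (g ∩ γ.toZFSet) l.toZFSet (g ∩ l.toZFSet)) ∧
      ∀ l < κ, γ < l → (∀ y ≤ l, γ < y → pair γ.toZFSet y.toZFSet ∉ f) →
        ∀ h, h ⊆ l.toZFSet → h ∩ γ.toZFSet = g ∩ γ.toZFSet →
          ∃ c, IsEmbedding A c ∧ IsStretch c γ.toZFSet (g ∩ γ.toZFSet) l.toZFSet h) :
    IsCoherent κ.toZFSet g f (ZFSet.sep (IsEmbedding A) (V_ η)) := by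
  intro γ' hγ' hcl
  obtain ⟨γ, hγ, rfl⟩ := Ordinal.mem_toZFSet_iff.1 hγ'
  obtain ⟨h₁, h₂⟩ := hbook γ hγ fun β hβ y hy hyf => Ordinal.toZFSet_subset_toZFSet_iff.1
    (hcl _ (Ordinal.toZFSet_mem_toZFSet_iff.2 hβ) _ (Ordinal.toZFSet_mem_toZFSet_iff.2 hy) hyf)
  refine ⟨?_, ?_⟩
  · rintro y hy hyf x rfl h rfl c hc
    obtain ⟨l, hl, rfl⟩ := Ordinal.mem_toZFSet_iff.1 hy
    exact h₁ l hl hyf c (mem_sep.1 hc).2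
  · intro l' hl' hγl
    obtain ⟨l, hl, rfl⟩ := Ordinal.mem_toZFSet_iff.1 hl'
    rw [Ordinal.toZFSet_mem_toZFSet_iff] at hγl
    refine or_iff_not_imp_left.2 fun hno => ?_
    rintro x rfl h hhl hx
    obtain ⟨c, hc⟩ := h₂ l hl hγl (fun y hy hγy hyf => hno ⟨y.toZFSet,
      Ordinal.toZFSet_mem_toZFSet_iff.2 (hy.trans_lt hl), hyf,
      Ordinal.toZFSet_mem_toZFSet_iff.2 hγy, hy.lt_or_eq.imp
        Ordinal.toZFSet_mem_toZFSet_iff.2 (congrArg _)⟩) h hhl hx.symm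
    obtain ⟨c, hcη, hc⟩ := hη _ (toZFSet_mem_vonNeumann.2 hγ) _
      (mem_vonNeumann_of_subset (fun z hz => (mem_inter.1 hz).2) (toZFSet_mem_vonNeumann.2 hγ)) _
      (toZFSet_mem_vonNeumann.2 hl) h
      (mem_vonNeumann_of_subset hhl (toZFSet_mem_vonNeumann.2 hl)) ⟨c, hc⟩
    exact ⟨c, mem_sep.2 ⟨hcη, hc.1⟩, hc.2⟩

/-! ### Reflection at `κ` and the conclusion. -/

/-- If `g` and `f` are coherent and an elementary embedding `J` of sufficiently large degree exists,
then every extension of `g` is realised by the code of some embedding. -/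
theorem IsTransfer.exists_isStretch {A : Class.{u}} {κ l η μ θ : Ordinal.{u}}
    {J : ZFSet.{u} → ZFSet.{u}} {g f h : ZFSet.{u}} (hJ : IsTransfer A μ θ J)
    (hfix : ∀ β < κ, J β.toZFSet = β.toZFSet) (hμκ : μ.toZFSet ∈ J κ.toZFSet)
    (hω : Ordinal.omega0 < κ) (hη : Order.IsSuccLimit η) (hκl : κ < l) (hlη : l < η) (hμ : η < μ)
    (hg : g ⊆ κ.toZFSet) (hfκ : f ⊆ prod κ.toZFSet κ.toZFSet)
    (hfb : ∀ β < κ, ∃ δ < κ, ∀ y, pair β.toZFSet y ∈ f → y ⊆ δ.toZFSet)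
    (hcoh : IsCoherent κ.toZFSet g f (ZFSet.sep (IsEmbedding A) (V_ η)))
    (hhl : h ⊆ l.toZFSet) (hhg : h ∩ κ.toZFSet = g) :
    ∃ c, IsEmbedding A c ∧ IsStretch c κ.toZFSet g l.toZFSet h := by
  set W := ZFSet.sep (IsEmbedding A) (V_ η) with hW
  have hκη : κ < η := hκl.trans hlη
  have hηm : V_ η ∈ V_ μ := by simpa
  have hWm : W ∈ V_ μ := mem_vonNeumann_of_subset sep_subset hηm
  have hκm : κ.toZFSet ∈ V_ μ := toZFSet_mem_vonNeumann.2 (hκη.trans hμ)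
  have hgm : g ∈ V_ μ := mem_vonNeumann_of_subset hg hκm
  have hβm : ∀ β < κ, β.toZFSet ∈ V_ μ := fun β hβ =>
    toZFSet_mem_vonNeumann.2 (hβ.trans (hκη.trans hμ))
  have hfm : f ∈ V_ μ := by
    refine mem_vonNeumann_of_subset (fun p hp => ?_) hηm
    obtain ⟨a, ha, b, hb, rfl⟩ := mem_prod.1 (hfκ hp)
    have hκη' := toZFSet_mem_vonNeumann.2 hκη
    exact pair_mem_vonNeumann hη (isTransitive_vonNeumann _ _ hκη' ha)
      (isTransitive_vonNeumann _ _ hκη' hb)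
  have hJW := hJ.mem_map_embeddings_iff hη (hω.trans hκη) hμ fun β hβ => hfix β (hβ.trans_lt hω)
  rw [← hW] at hJW
  have htrans : ∀ x ∈ J κ.toZFSet, x ⊆ J κ.toZFSet :=
    (hJ.map_iff₁ (P := fun x => ∀ y ∈ x, y ⊆ x) (.ball (.subset _ _)) hκm).1
      (ZFSet.isOrdinal_toZFSet κ).isTransitive
  have hltJ : ∀ β ≤ μ, β.toZFSet ∈ J κ.toZFSet := fun β hβ => by
    rcases hβ.lt_or_eq with hβ | rfl
    · exact htrans _ hμκ (Ordinal.toZFSet_mem_toZFSet_iff.2 hβ)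
    · exact hμκ
  have hJg : J g ∩ κ.toZFSet = g := by
    refine ext_of_subset_toZFSet (fun z hz => (mem_inter.1 hz).2) hg fun β hβ => ?_
    rw [mem_inter, Ordinal.toZFSet_mem_toZFSet_iff, and_iff_left hβ, hJ.mem_iff (hβm β hβ) hgm,
      hfix β hβ]
  -- Coherence of the images is applied at `κ ∈ J(κ)`. The stage `κ` is closed under `J(f)`: for `β
  -- < κ` the values of `f` at `β` are bounded by some `δ < κ`, and `J` fixes both `β` and `δ`.
  obtain ⟨h₁, h₂⟩ := (hJ.map_iff₄ (P := IsCoherent) (.isCoherent _ _ _ _) hκm hgm hfm hWm).1 hcoh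
    κ.toZFSet (hltJ κ (hκη.trans hμ).le) (by
      intro b hb y _ hyf
      obtain ⟨β, hβ, rfl⟩ := Ordinal.mem_toZFSet_iff.1 hb
      obtain ⟨δ, hδ, hδf⟩ := hfb β hβ
      have h := (hJ.map_iff₃ (P := fun b d f => ∀ p ∈ f, ∀ y, p = pair b y → y ⊆ d)
        (.ball (.all (.imp (.eq_pair _ _ _) (.subset _ _)) fun v y hy => ⟨.inr (), by
          rw [(Classical.not_imp.1 hy).1]
          exact (rank_right_lt_rank_pair _ _).le⟩)) (hβm β hβ) (hβm δ hδ) hfm).1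
        fun p hp y hpy => hδf y (hpy ▸ hp)
      rw [hfix β hβ, hfix δ hδ] at h
      exact (h _ hyf y rfl).trans (Ordinal.toZFSet_subset_toZFSet_iff.2 hδ.le))
  rcases h₂ l.toZFSet (hltJ l (hlη.trans hμ).le) (Ordinal.toZFSet_mem_toZFSet_iff.2 hκl) with
    ⟨y, hyκ, hyf, hκy, hyl⟩ | h₂
  -- Here `J(f)` prescribes some `s ≤ l` at `κ`. The restriction of `J` to `V_ s` realises `J(g) ∩
  -- s`, and its code lies in `J(W)`, against coherence.
  · exfalso
    obtain ⟨s, hsl, rfl⟩ : ∃ s ≤ l, y = s.toZFSet := by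
      rcases hyl with hyl | rfl
      · obtain ⟨s, hs, rfl⟩ := Ordinal.mem_toZFSet_iff.1 hyl
        exact ⟨s, hs.le, rfl⟩
      · exact ⟨l, le_rfl, rfl⟩
    rw [Ordinal.toZFSet_mem_toZFSet_iff] at hκy
    have hsη : s < η := hsl.trans_lt hlη
    have hsm : V_ s ∈ V_ μ := by simpa using hsη.trans hμ
    obtain ⟨η', hη'⟩ := hJ.map_vonNeumann hμ
    have hsη' : s < η' := by
      have : J κ.toZFSet ∈ V_ η' := by
        rw [← hη', ← hJ.mem_iff hκm hηm]
        exact toZFSet_mem_vonNeumann.2 hκη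
      exact toZFSet_mem_vonNeumann.1 (isTransitive_vonNeumann _ _ this
        (hltJ s (hsη.trans hμ).le))
    -- That `η` is a limit is expressed by every element of `V_ η` lying in another one. The image
    -- level is then closed under pairing and contains the code of the restriction.
    have hη'lim : Order.IsSuccLimit η' := by
      have h := (hJ.map_iff₁ (P := fun x => ∀ y ∈ x, ∃ z ∈ x, y ∈ z) (.ball (.bex (.mem _ _)))
        hηm).1 fun y hy => ⟨V_ (Order.succ y.rank), vonNeumann_mem_of_lt
          (hη.succ_lt (mem_vonNeumann.1 hy)), mem_vonNeumann_succ y⟩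
      rw [hη'] at h
      refine Ordinal.isSuccLimit_iff.2 ⟨(bot_le.trans_lt hsη').ne',
        Order.isSuccPrelimit_of_succ_lt fun α hα => ?_⟩
      obtain ⟨z, hz, hαz⟩ := h α.toZFSet (toZFSet_mem_vonNeumann.2 hα)
      have := rank_lt_of_mem hαz
      rw [Ordinal.rank_toZFSet] at this
      exact (Order.succ_le_of_lt this).trans_lt (mem_vonNeumann.1 hz)
    have hcW : restrictCode J (V_ s) ∈ J W := by
      refine (hJW _).2 ⟨?_, hJ.isEmbedding_restrictCode (hsη.trans hμ)⟩
      rw [hη']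
      refine restrictCode_mem_vonNeumann hη'lim (by simpa) ?_
      rw [← hη', ← hJ.mem_iff hsm hηm]
      simpa
    refine h₁ _ hyκ hyf _ rfl _ rfl _ hcW ⟨_, _, _, isTriple_restrictCode _ _,
      ⟨fun h => ?_, fun β hβ => ?_⟩, fun b hb => ?_, J κ.toZFSet, J g, ?_, hltJ s (hsη.trans hμ).le,
      ?_, rfl⟩
    · exact lt_irrefl _ (toZFSet_mem_vonNeumann.1 h)
    · exact s.toZFSet_subset_vonNeumann hβ
    · obtain ⟨β, hβ, rfl⟩ := Ordinal.mem_toZFSet_iff.1 hb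
      exact (hJ.pair_mem_graphOn hsm).2
        ⟨toZFSet_mem_vonNeumann.2 (hβ.trans hκy), (hfix β hβ).symm⟩
    · exact (hJ.pair_mem_graphOn hsm).2 ⟨toZFSet_mem_vonNeumann.2 hκy, rfl⟩
    · rw [hJg]
      exact (hJ.pair_mem_graphOn hsm).2
        ⟨mem_vonNeumann_of_subset hg (toZFSet_mem_vonNeumann.2 hκy), rfl⟩
  · obtain ⟨c, hcW, hc⟩ := h₂ _ rfl h hhl (hJg.trans hhg.symm)
    rw [hJg] at hc
    exact ⟨c, ((hJW c).1 hcW).2, hc⟩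

end AExtendible

theorem theorem1p2 (A : Class.{u}) (κ : Cardinal.{u}) (hκ : AExtendible.IsExtendible A κ) :
    ∃ (g : ZFSet.{u}) (hg : g ⊆ κ.ord.toZFSet), AExtendible.IsStretchable A κ g hg := by
  open AExtendible ZFSet in
  obtain ⟨g, f, hg, hf, hfb, hbook⟩ := exists_bookkeeping κ.ord
    (fun γ x l h => γ < l ∧ h ⊆ l.toZFSet ∧ h ∩ γ.toZFSet = x ∧
      ∀ c, IsEmbedding A c → ¬ IsStretch c γ.toZFSet x l.toZFSet h)
    fun _ _ _ _ h => ⟨h.1, h.2.1, h.2.2.1⟩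
  refine ⟨g, hg, fun l hl h hhl hhg => ?_⟩
  obtain ⟨η₀, hη₀⟩ := exists_bound_of_stretch A κ.ord
  -- Adding `ω` gives a limit above both `l` and the bound for codes. The degree `η + 1` used below
  -- makes `V_ η` and its subsets elements of the domain.
  have hη : Order.IsSuccLimit (max η₀ l + Ordinal.omega0) :=
    Ordinal.isSuccLimit_add _ Ordinal.isSuccLimit_omega0
  have hlt : max η₀ l < max η₀ l + Ordinal.omega0 := by simp
  set η := max η₀ l + Ordinal.omega0
  have hlη : l < η := (le_max_right _ _).trans_lt hlt
  have hμ : η < Order.succ η := Order.lt_succ _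
  obtain ⟨θ, j, ⟨-, hj⟩, hjκ⟩ := hκ (Order.succ η) (hl.trans (hlη.trans hμ))
  have hcoh : IsCoherent κ.ord.toZFSet g f (ZFSet.sep (IsEmbedding A) (V_ η)) := by
    refine isCoherent_of_bookkeeping (fun γ hγ x hx l hl h hh hc => ?_) fun γ hγ hcl => ?_
    · obtain ⟨c, hc, h⟩ := hη₀ γ hγ x hx l hl h hh hc
      exact ⟨c, vonNeumann_subset_of_le ((le_max_left _ _).trans hlt.le) hc, h⟩
    · obtain ⟨h₁, h₂⟩ := hbook γ hγ hcl
      refine ⟨fun l hl hlf => (h₁ l hl hlf).2.2.2, fun l hl hγl hno h hhl hhg => ?_⟩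
      by_contra! hne
      exact h₂ l hl hno h ⟨hγl, hhl, hhg, hne⟩
  obtain ⟨c, hc, hs⟩ := (isTransfer_extendMap j).exists_isStretch
    (fun β hβ => (extendMap_coe j (Level.ofOrdinal A _)).trans
      (hj β (hβ.trans (hl.trans (hlη.trans hμ))) hβ))
    (by rwa [show extendMap j κ.ord.toZFSet = _ from extendMap_coe j (Level.ofOrdinal A _)])
    hκ.omega0_lt hη hl hlη hμ hg hf hfb hcoh hhl hhg
  exact exists_isExtendibilityEmbedding hl hg hc hs
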